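/- Let $P\subset\mathbb{R}^3$ be a toric diagram, i.e. a two-dimensional convex polygon all of whose vertices (extreme points) are integral points of the form $(*,*,1)\in\mathbb{Z}^3$, and let $\mathbf v_1,\dots,\mathbf v_n$ be its distinct vertices in counter-clockwise order, so that $\det(\mathbf v_i,\mathbf v_j,\mathbf v_k)>0$ for $1\le i<j<k\le n$. For $\phi=(\phi^1,\dots,\phi^n)\in\mathbb{R}_{\ge 0}^n$ put $$\hat F_P(\phi)=\sum_{1\le i<j<k\le n}|\det(\mathbf v_i,\mathbf v_j,\mathbf v_k)|\,\phi^i\phi^j\phi^k ,$$ and let $$\mathcal Z_P(\phi)=\phi^1\,\mathrm{conv}(\mathbf 0,\mathbf v_1)+\dots+\phi^n\,\mathrm{conv}(\mathbf 0,\mathbf v_n)\subset\mathbb{R}^3$$ be the zonotope formed by the Minkowski sum of the dilated segments. For $N\in\mathbb{N}$ let the trial $a$-function be $$a(\phi)=\frac{9}{32}\,\frac{N^2}{2}\sum_{i,j,k=1}^{n}|\det(\mathbf v_i,\mathbf v_j,\mathbf v_k)|\,\phi^i\phi^j\phi^k .$$ Then for every $\phi\in\mathbb{R}_{\ge 0}^n$,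 $\hat F_P(\phi)$ is equal to the three-dimensional volume $\mathrm{vol}(\mathcal Z_P(\phi))$ (Lebesgue measure on $\mathbb{R}^3$), and $$a(\phi)=\frac{27}{32}N^2\,\hat F_P(\phi)=\frac{27}{32}N^2\,\mathrm{vol}(\mathcal Z_P(\phi)).$$ -/

import Mathlib

open MeasureTheory
open scoped Pointwise

/-- Euclidean three-space; its `volume` is three-dimensional Lebesgue measure. -/
abbrev Space3 : Type := EuclideanSpace ℝ (Fin 3)

/-- A toric diagram: a two-dimensional convex polygon in `ℝ³` all of whose vertices
(extreme points) are integral points of the form `(*, *, 1)`. -/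
structure IsToricDiagram (P : Set Space3) : Prop where
  isPolytope : ∃ S : Set Space3, S.Finite ∧ P = convexHull ℝ S
  twoDimensional : Module.finrank ℝ (vectorSpan ℝ P) = 2
  integralVertices : ∀ x ∈ P.extremePoints ℝ, (∃ a b : ℤ, x 0 = a ∧ x 1 = b) ∧ x 2 = 1

/-- The determinant of the `3 × 3` matrix with columns `u`, `v`, `w`. -/
noncomputable def bracket (u v w : Space3) : ℝ :=
  (Matrix.of fun r c : Fin 3 => (![u, v, w] c) r).det

/-- `v` lists the vertices of the polygon `P`, without repetition, in counter-clockwise order. -/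
structure IsVertexList (P : Set Space3) {n : ℕ} (v : Fin n → Space3) : Prop where
  injective : Function.Injective v
  range_eq : Set.range v = P.extremePoints ℝ
  counterclockwise : ∀ i j k : Fin n, i < j → j < k → 0 < bracket (v i) (v j) (v k)

/-- The cubic `∑_{i < j < k} |det (v i, v j, v k)| φⁱ φʲ φᵏ`. -/
noncomputable def cubicF {n : ℕ} (v : Fin n → Space3) (φ : Fin n → ℝ) : ℝ :=
  ∑ i : Fin n, ∑ j ∈ Finset.Ioi i, ∑ k ∈ Finset.Ioi j,
    |bracket (v i) (v j) (v k)| * φ i * φ j * φ k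

/-- The zonotope `∑ᵢ φⁱ conv(0, v i)`: Minkowski sum of dilated segments. -/
noncomputable def zonotope {n : ℕ} (v : Fin n → Space3) (φ : Fin n → ℝ) : Set Space3 :=
  ∑ i : Fin n, φ i • convexHull ℝ {0, v i}

/-- The trial `a`-function
`(9/32) (N²/2) ∑_{i,j,k} |det (v i, v j, v k)| φⁱ φʲ φᵏ`, the sum being over all triples. -/
noncomputable def trialA (N : ℕ) {n : ℕ} (v : Fin n → Space3) (φ : Fin n → ℝ) : ℝ :=
  9 / 32 * ((N : ℝ) ^ 2 / 2) *
    ∑ i : Fin n, ∑ j : Fin n, ∑ k : Fin n,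
      |bracket (v i) (v j) (v k)| * φ i * φ j * φ k

/-! Adding a segment to a convex body adds its length times the volume of the body's projection
along it (`volume_add_segment_single`, by Fubini). The projection of a zonotope is a zonotope one
dimension lower, so induction on the generators gives the volume in dimensions 1, 2 and 3 in turn:
in dimension 3 it is one sixth of the sum of |det| over all triples of generators. Symmetry of |det|
turns the sum over all triples into six times the sum over increasing ones, which gives both the
volume formula and the constant 27/32 = 6 · 9/64. -/

/-- Adding a segment of length `|c|` to a nonempty compact convex set of reals lengthens it
by `|c|`. -/
theorem volume_add_segment_real {F : Set ℝ} (hne : F.Nonempty) (hc : Convex ℝ F)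
    (hk : IsCompact F) (c : ℝ) :
    volume (F + segment ℝ 0 c) = volume F + ENNReal.ofReal |c| := by
  have hF := eq_Icc_of_connected_compact ⟨hne, hc.isPreconnected⟩ hk
  have hle : sInf F ≤ sSup F := by
    by_contra h
    rw [Set.Icc_eq_empty h] at hF
    exact hne.ne_empty hF
  rw [hF, segment_eq_uIcc, Set.uIcc, Set.Icc_add_Icc hle inf_le_sup, Real.volume_Icc,
    Real.volume_Icc, ← ENNReal.ofReal_add (sub_nonneg.2 hle) (abs_nonneg c)]
  congr 1
  rcases le_total 0 c with h | h
  · simp only [inf_of_le_left h, sup_of_le_right h, abs_of_nonneg h]; ring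
  · simp only [inf_of_le_right h, sup_of_le_left h, abs_of_nonpos h]; ring

theorem mem_segment_single_iff {d : ℕ} (i : Fin (d + 1)) (c : ℝ) (x : Fin (d + 1) → ℝ) :
    x ∈ segment ℝ 0 (Pi.single i c : Fin (d + 1) → ℝ) ↔
      ∃ t ∈ segment ℝ 0 c, x = Pi.single i t := by
  simp only [segment_eq_image, Set.mem_image, smul_zero, zero_add]
  constructor
  · rintro ⟨t, ht, rfl⟩
    exact ⟨t • c, ⟨t, ht, rfl⟩, (Pi.single_smul (f := fun _ => ℝ) i t c).symm⟩
  · rintro ⟨_, ⟨t, ht, rfl⟩, rfl⟩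
    exact ⟨t, ht, (Pi.single_smul (f := fun _ => ℝ) i t c).symm⟩

/-- The volume of a convex body swept along a segment in a coordinate direction grows by the
length of the segment times the volume of the projection along that direction. -/
theorem volume_add_segment_single {d : ℕ} (i : Fin (d + 1)) {K : Set (Fin (d + 1) → ℝ)}
    (hc : Convex ℝ K) (hk : IsCompact K) (c : ℝ) :
    volume (K + segment ℝ 0 (Pi.single i c)) =
      volume K + ENNReal.ofReal |c| * volume (i.removeNth '' K) := by
  have hfib : ∀ S : Set (Fin (d + 1) → ℝ), IsCompact S →
      volume S = ∫⁻ y : Fin d → ℝ, volume {t : ℝ | i.insertNth t y ∈ S} := by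
    intro S hS
    have h := ((volume_preserving_piFinSuccAbove (fun _ => ℝ) i).symm
      (MeasurableEquiv.piFinSuccAbove (fun _ => ℝ) i)).measure_preimage_equiv S
    rw [← h, Measure.volume_eq_prod, Measure.prod_apply_symm]
    · rfl
    · exact (MeasurableEquiv.piFinSuccAbove (fun _ => ℝ) i).symm.measurable hS.measurableSet
  have hcont : Continuous (fun x : Fin (d + 1) → ℝ => i.removeNth x) := by
    unfold Fin.removeNth; fun_prop
  have hseg : IsCompact (segment ℝ 0 (Pi.single i c : Fin (d + 1) → ℝ)) := by
    rw [segment_eq_image]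
    exact isCompact_Icc.image (by fun_prop)
  have hproj : MeasurableSet (i.removeNth '' K) := (hk.image hcont).measurableSet
  rw [hfib _ (hk.add hseg), hfib _ hk, ← setLIntegral_const, ← lintegral_indicator hproj,
    ← lintegral_add_right _ (measurable_const.indicator hproj)]
  -- Fibrewise: over the projection of `K` the fibre is a nonempty compact interval and gains length
  -- `|c|`; elsewhere it is empty and stays so.
  refine lintegral_congr fun y => ?_
  have hsum : {t : ℝ | i.insertNth t y ∈ K + segment ℝ 0 (Pi.single i c)} =
      {t : ℝ | i.insertNth t y ∈ K} + segment ℝ 0 c := by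
    ext t
    simp only [Set.mem_ofPred_eq, Set.mem_add, mem_segment_single_iff]
    constructor
    · rintro ⟨x, hx, _, ⟨s, hs, rfl⟩, hxs⟩
      refine ⟨t - s, ?_, s, hs, by ring⟩
      convert hx using 1
      have : x = i.insertNth t y - Pi.single i s := by rw [← hxs]; simp
      rw [this]
      ext j
      refine i.succAboveCases ?_ (fun k => ?_) j <;> simp
    · rintro ⟨r, hr, s, hs, rfl⟩
      refine ⟨_, hr, _, ⟨s, hs, rfl⟩, ?_⟩
      ext j
      refine i.succAboveCases ?_ (fun k => ?_) j <;> simp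
  rw [hsum]
  by_cases hy : y ∈ i.removeNth '' K
  · rw [Set.indicator_of_mem hy]
    obtain ⟨x, hx, rfl⟩ := hy
    refine volume_add_segment_real ⟨x i, by simpa using hx⟩ ?_ ?_ c
    · intro a ha b hb p q hp hq hpq
      have := hc ha hb hp hq hpq
      simp only [Set.mem_ofPred_eq]
      convert this using 1
      ext j
      refine i.succAboveCases ?_ (fun k => ?_) j
      · simp
      · simp [← add_mul, hpq, Fin.removeNth]
    · have hins : Continuous
          (fun t : ℝ => (i.insertNth t (i.removeNth x) : Fin (d + 1) → ℝ)) :=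
        Continuous.finInsertNth (A := fun _ => ℝ) i (f := fun t : ℝ => t) continuous_id
          (g := fun _ => i.removeNth x) continuous_const
      have hl : Function.LeftInverse (fun z : Fin (d + 1) → ℝ => z i)
          (fun t : ℝ => (i.insertNth t (i.removeNth x) : Fin (d + 1) → ℝ)) := by
        intro t; simp
      exact (hl.isClosedEmbedding (continuous_apply i) hins).isCompact_preimage hk
  · rw [Set.indicator_of_notMem hy, add_zero]
    have hempty : {t : ℝ | i.insertNth t y ∈ K} = ∅ := by
      refine Set.eq_empty_of_forall_notMem fun t ht => hy ⟨_, ht, by simp⟩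
    rw [hempty, Set.empty_add]

/-! ### Volumes of zonotopes in dimensions one to three -/

/-- The sum of the segments from the origin to the vectors `u i`, `i ∈ s`. -/
noncomputable def segmentSum {ι E : Type*} [AddCommGroup E] [Module ℝ E] (s : Finset ι)
    (u : ι → E) : Set E :=
  ∑ i ∈ s, segment ℝ 0 (u i)

theorem image_segmentSum {ι E F : Type*} [AddCommGroup E] [Module ℝ E] [AddCommGroup F]
    [Module ℝ F] (f : E →ₗ[ℝ] F) (s : Finset ι) (u : ι → E) :
    f '' segmentSum s u = segmentSum s (fun i => f (u i)) := by
  rw [segmentSum, Set.image_finsetSum]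
  refine Finset.sum_congr rfl fun i _ => ?_
  simpa using image_segment ℝ f.toAffineMap 0 (u i)

theorem convex_segmentSum {ι E : Type*} [AddCommGroup E] [Module ℝ E] (s : Finset ι)
    (u : ι → E) : Convex ℝ (segmentSum s u) :=
  convex_sum _ fun i _ => convex_segment 0 (u i)

theorem segmentSum_insert {ι E : Type*} [DecidableEq ι] [AddCommGroup E] [Module ℝ E]
    {s : Finset ι} {a : ι} (ha : a ∉ s) (u : ι → E) :
    segmentSum (insert a s) u = segmentSum s u + segment ℝ 0 (u a) := by
  rw [segmentSum, Finset.sum_insert ha, add_comm]; rfl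

theorem isCompact_segmentSum {ι E : Type*} [AddCommGroup E] [Module ℝ E] [TopologicalSpace E]
    [ContinuousAdd E] [ContinuousSMul ℝ E] (s : Finset ι) (u : ι → E) :
    IsCompact (segmentSum s u) := by
  classical
  induction s using Finset.induction_on with
  | empty => exact isCompact_singleton
  | insert a s ha ih =>
    rw [segmentSum_insert ha]
    refine ih.add ?_
    rw [segment_eq_image]
    exact isCompact_Icc.image (by fun_prop)

/-- `volume_add_segment_single` for a general direction `w`, after a linear change of
coordinates sending `w` to a multiple of the `i`-th coordinate vector. -/
theorem volume_real_segmentSum_insert {ι : Type*} [DecidableEq ι] {d : ℕ} (i : Fin (d + 1))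
    {s : Finset ι} {a : ι} (ha : a ∉ s) (u : ι → Fin (d + 1) → ℝ)
    (T : Matrix (Fin (d + 1)) (Fin (d + 1)) ℝ) {c : ℝ}
    (hT : T.mulVec (u a) = Pi.single i c) :
    |T.det| * volume.real (segmentSum (insert a s) u) =
      |T.det| * volume.real (segmentSum s u) +
        |c| * volume.real (segmentSum s fun j => i.removeNth (T.mulVec (u j))) := by
  have himg : ∀ S : Set (Fin (d + 1) → ℝ),
      |T.det| * volume.real S = volume.real (T.toLin' '' S) := by
    intro S
    rw [measureReal_def, measureReal_def, Measure.addHaar_image_linearMap, LinearMap.det_toLin',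
      ENNReal.toReal_mul, ENNReal.toReal_ofReal (abs_nonneg _)]
  rw [himg, himg, image_segmentSum, image_segmentSum, segmentSum_insert ha]
  simp only [Matrix.toLin'_apply, hT]
  have hk := isCompact_segmentSum s fun j => T.mulVec (u j)
  have hp : i.removeNth '' (segmentSum s fun j => T.mulVec (u j)) =
      segmentSum s fun j => i.removeNth (T.mulVec (u j)) :=
    image_segmentSum (LinearMap.funLeft ℝ ℝ i.succAbove) s _
  rw [measureReal_def, volume_add_segment_single i (convex_segmentSum _ _) hk, hp,
    ENNReal.toReal_add hk.measure_lt_top.ne, ENNReal.toReal_mul,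
    ENNReal.toReal_ofReal (abs_nonneg _)]
  · rfl
  · exact ENNReal.mul_ne_top ENNReal.ofReal_ne_top (isCompact_segmentSum _ _).measure_lt_top.ne

/-- Zero generators need separate treatment: the matrices chosen below then have determinant 0,
which cannot be cancelled. -/
theorem volume_real_segmentSum_insert_of_eq_zero {ι : Type*} [DecidableEq ι] {d : ℕ}
    {s : Finset ι} {a : ι} (ha : a ∉ s) (u : ι → Fin d → ℝ) (h0 : u a = 0) :
    volume.real (segmentSum (insert a s) u) = volume.real (segmentSum s u) := by
  rw [segmentSum_insert ha, h0, segment_same]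
  simp

theorem volume_real_segmentSum_one {ι : Type*} (s : Finset ι) (u : ι → Fin 1 → ℝ) :
    volume.real (segmentSum s u) = ∑ i ∈ s, |u i 0| := by
  classical
  induction s using Finset.induction_on with
  | empty =>
    simp [segmentSum, measureReal_def, ← Set.singleton_zero]
  | insert a s ha ih =>
    have h := volume_real_segmentSum_insert (c := u a 0) 0 ha u 1 (by
      ext j; fin_cases j; simp)
    -- The projection is a nonempty subset of the one-point space `Fin 0 → ℝ`, whose volume is 1.
    have h1 : volume.real (segmentSum s fun j => (0 : Fin 1).removeNth (u j)) = 1 := by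
      have hne : (segmentSum s fun j => (0 : Fin 1).removeNth (u j)).Nonempty :=
        ⟨0, by
          rw [segmentSum, Set.mem_finsetSum]
          exact ⟨fun _ => 0, fun _ => left_mem_segment ℝ _ _, by simp⟩⟩
      rw [Set.Nonempty.eq_univ hne]
      rw [measureReal_def, volume_pi, Measure.pi_of_empty]
      simp
    simp only [Matrix.det_one, abs_one, one_mul, Matrix.one_mulVec, h1, mul_one, ih] at h
    rw [h, Finset.sum_insert ha, add_comm]

/-- Area of a planar zonotope. -/
theorem volume_real_segmentSum_two {ι : Type*} (s : Finset ι) (u : ι → Fin 2 → ℝ) :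
    2 * volume.real (segmentSum s u) =
      ∑ i ∈ s, ∑ j ∈ s, |(Matrix.of ![u i, u j]).det| := by
  classical
  simp only [Matrix.det_fin_two, Matrix.of_apply, Matrix.cons_val_zero, Matrix.cons_val_one]
  induction s using Finset.induction_on with
  | empty => simp [segmentSum, measureReal_def, ← Set.singleton_zero]
  | insert a s ha ih =>
    have key : volume.real (segmentSum (insert a s) u) =
        volume.real (segmentSum s u) + ∑ j ∈ s, |u a 0 * u j 1 - u a 1 * u j 0| := by
      by_cases h0 : u a = 0
      · rw [volume_real_segmentSum_insert_of_eq_zero ha u h0]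
        simp [h0]
      · set q := u a 0 ^ 2 + u a 1 ^ 2 with hq
        have hpos : 0 < q := by
          rcases (show u a 0 ≠ 0 ∨ u a 1 ≠ 0 by
            by_contra! h
            exact h0 (by ext j; fin_cases j; exacts [h.1, h.2])) with h | h <;> positivity
        -- A rotation scaled by |u a|: it sends `u a` to (q, 0), and its second coordinate is x ↦
        -- det(u a, x).
        have h := volume_real_segmentSum_insert (c := q) 0 ha u
          !![u a 0, u a 1; -u a 1, u a 0] (by
            ext j
            fin_cases j
            · simp [Matrix.mulVec, dotProduct, Fin.sum_univ_two, hq]; ring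
            · simp [Matrix.mulVec, dotProduct, Fin.sum_univ_two]; ring)
        have hdet : (!![u a 0, u a 1; -u a 1, u a 0] : Matrix _ _ ℝ).det = q := by
          rw [Matrix.det_fin_two_of, hq]; ring
        rw [hdet, abs_of_pos hpos, volume_real_segmentSum_one, ← mul_add] at h
        rw [mul_left_cancel₀ hpos.ne' h]
        congr 1
        refine Finset.sum_congr rfl fun j _ => ?_
        congr 1
        simp [Fin.removeNth, Matrix.mulVec, dotProduct, Fin.sum_univ_two]
        ring
    have hsymm : ∀ j, |u j 0 * u a 1 - u j 1 * u a 0| = |u a 0 * u j 1 - u a 1 * u j 0| :=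
      fun j => by rw [abs_sub_comm]; congr 1; ring
    simp only [Finset.sum_insert ha, Finset.sum_add_distrib, ← ih, key, hsymm]
    rw [mul_comm (u a 0), sub_self, abs_zero]
    ring

/-- Volume of a zonotope in three-space none of whose nonzero generators is horizontal. -/
theorem volume_real_segmentSum_three {ι : Type*} (s : Finset ι) (u : ι → Fin 3 → ℝ)
    (hu : ∀ i, u i = 0 ∨ u i 2 ≠ 0) :
    6 * volume.real (segmentSum s u) =
      ∑ i ∈ s, ∑ j ∈ s, ∑ k ∈ s, |(Matrix.of ![u i, u j, u k]).det| := by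
  classical
  set D : ι → ι → ι → ℝ := fun i j k => |(Matrix.of ![u i, u j, u k]).det| with hD
  change _ = ∑ i ∈ s, ∑ j ∈ s, ∑ k ∈ s, D i j k
  have hrot : ∀ i j k, D i j k = D j k i := fun i j k => by
    simp only [hD, Matrix.det_fin_three]; congr 1; simp; ring
  have hswap : ∀ i j k, D i j k = D j i k := fun i j k => by
    simp only [hD]; rw [← abs_neg]; simp only [Matrix.det_fin_three]; congr 1; simp; ring
  have hdiag : ∀ i k, D i i k = 0 := fun i k => by
    simp only [hD, Matrix.det_fin_three]; rw [abs_eq_zero]; simp; ring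
  induction s using Finset.induction_on with
  | empty => simp [segmentSum, measureReal_def, ← Set.singleton_zero]
  | insert a s ha ih =>
    have key : 2 * volume.real (segmentSum (insert a s) u) =
        2 * volume.real (segmentSum s u) + ∑ i ∈ s, ∑ j ∈ s, D a i j := by
      rcases hu a with h0 | h0
      · rw [volume_real_segmentSum_insert_of_eq_zero ha u h0]
        simp [hD, Matrix.det_fin_three, h0]
      · set c := u a 2 with hc
        -- This matrix sends `u a` to (0, 0, c). Its first two rows are c times the projection along
        -- `u a` to the horizontal plane, so the planar minors are c · det(u a, u i, u j).
        have h := volume_real_segmentSum_insert (c := c) 2 ha u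
          !![c, 0, -u a 0; 0, c, -u a 1; 0, 0, 1] (by
            ext j
            fin_cases j
            · simp [Matrix.mulVec, dotProduct, Fin.sum_univ_three, ← hc]; ring
            · simp [Matrix.mulVec, dotProduct, Fin.sum_univ_three, ← hc]; ring
            · simp [Matrix.mulVec, dotProduct, Fin.sum_univ_three, ← hc])
        have hdet : (!![c, 0, -u a 0; 0, c, -u a 1; 0, 0, 1] : Matrix _ _ ℝ).det = c * c := by
          simp [Matrix.det_fin_three]
        rw [hdet, abs_mul] at h
        have h2 := volume_real_segmentSum_two s
          (fun j => (2 : Fin 3).removeNth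
            (!![c, 0, -u a 0; 0, c, -u a 1; 0, 0, 1].mulVec (u j)))
        have hminor : ∀ i j, |(Matrix.of ![(2 : Fin 3).removeNth
            (!![c, 0, -u a 0; 0, c, -u a 1; 0, 0, 1].mulVec (u i)), (2 : Fin 3).removeNth
            (!![c, 0, -u a 0; 0, c, -u a 1; 0, 0, 1].mulVec (u j))]).det| = |c| * D a i j := by
          intro i j
          have h20 : (2 : Fin 3).succAbove (0 : Fin 2) = 0 := rfl
          have h21 : (2 : Fin 3).succAbove (1 : Fin 2) = 1 := rfl
          simp only [hD]
          rw [← abs_mul]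
          congr 1
          simp [Matrix.det_fin_two, Matrix.det_fin_three, Fin.removeNth, h20, h21,
            dotProduct, Fin.sum_univ_three, ← hc]
          ring
        simp only [hminor, ← Finset.mul_sum] at h2
        refine mul_left_cancel₀ (mul_ne_zero (abs_ne_zero.2 h0) (abs_ne_zero.2 h0)) ?_
        linear_combination 2 * h + |c| * h2
    have e1 : ∀ i j, D i a j = D a i j := fun i j => hswap i a j
    have e2 : ∀ i j, D i j a = D a i j := fun i j => (hrot a i j).symm
    -- The new index contributes once for each of its three positions; triples repeating it vanish.
    -- The result is three times `key`.
    simp only [Finset.sum_insert ha, Finset.sum_add_distrib, e1, e2, hdiag, ← ih,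
      Finset.sum_const_zero]
    linarith

/-! ### Ordered and unordered triples -/

/-- The sum over all triples of a symmetric function vanishing on the diagonals is six times
the sum over increasing triples. -/
theorem sum_triple_eq_six_mul_sum_Ioi {n : ℕ} (f : Fin n → Fin n → Fin n → ℝ)
    (hrot : ∀ i j k, f i j k = f j k i) (hswap : ∀ i j k, f i j k = f j i k)
    (hdiag : ∀ i k, f i i k = 0) :
    ∑ i, ∑ j, ∑ k, f i j k =
      6 * ∑ i, ∑ j ∈ Finset.Ioi i, ∑ k ∈ Finset.Ioi j, f i j k := by
  set A : Fin n → Fin n → Fin n → ℝ := fun i j k => if i < j ∧ j < k then f i j k else 0 with hA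
  have hd2 : ∀ i k, f k i i = 0 := fun i k => by rw [hrot, hdiag]
  have hd3 : ∀ i k, f i k i = 0 := fun i k => by rw [← hrot, hdiag]
  -- For distinct indices exactly one of the six permutations is increasing; with a repetition both
  -- sides vanish.
  have hdecomp : ∀ i j k, f i j k =
      A i j k + A i k j + A j i k + A j k i + A k i j + A k j i := by
    intro i j k
    have h1 : f i k j = f i j k := by rw [hrot i j k, hswap j k i, hrot i k j]
    have h2 : f j i k = f i j k := hswap _ _ _
    have h3 : f j k i = f i j k := (hrot _ _ _).symm
    have h4 : f k i j = f i j k := hrot _ _ _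
    have h5 : f k j i = f i j k := by rw [hswap, h3]
    simp only [hA, h1, h2, h3, h4, h5]
    rcases lt_trichotomy i j with hij | rfl | hij
    · rcases lt_trichotomy j k with hjk | rfl | hjk
      · simp [hij, hjk, hij.trans hjk, hij.not_gt, hjk.not_gt, (hij.trans hjk).not_gt]
      · simp [hd2]
      · rcases lt_trichotomy i k with hik | rfl | hik
        · simp [hij, hjk, hik, hij.not_gt, hjk.not_gt, hik.not_gt]
        · simp [hd3]
        · simp [hij, hjk, hik, hij.not_gt, hjk.not_gt, hik.not_gt]
    · simp [hdiag]
    · rcases lt_trichotomy j k with hjk | rfl | hjk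
      · rcases lt_trichotomy i k with hik | rfl | hik
        · simp [hij, hjk, hik, hij.not_gt, hjk.not_gt, hik.not_gt]
        · simp [hd3]
        · simp [hij, hjk, hik, hij.not_gt, hjk.not_gt, hik.not_gt]
      · simp [hd2]
      · simp [hij, hjk, hjk.trans hij, hij.not_gt, hjk.not_gt, (hjk.trans hij).not_gt]
  have hord : ∑ i, ∑ j ∈ Finset.Ioi i, ∑ k ∈ Finset.Ioi j, f i j k =
      ∑ i, ∑ j, ∑ k, A i j k := by
    refine Finset.sum_congr rfl fun i _ => ?_
    rw [← Finset.filter_lt_eq_Ioi, Finset.sum_filter]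
    refine Finset.sum_congr rfl fun j _ => ?_
    rw [← Finset.filter_lt_eq_Ioi, Finset.sum_filter]
    by_cases hij : i < j <;> simp [hA, hij]
  have c1 : ∀ B : Fin n → Fin n → Fin n → ℝ,
      ∑ i, ∑ j, ∑ k, B i k j = ∑ i, ∑ j, ∑ k, B i j k := fun B =>
    Finset.sum_congr rfl fun i _ => Finset.sum_comm
  have c2 : ∀ B : Fin n → Fin n → Fin n → ℝ,
      ∑ i, ∑ j, ∑ k, B j i k = ∑ i, ∑ j, ∑ k, B i j k := fun B => Finset.sum_comm
  have c3 : ∑ i, ∑ j, ∑ k, A j k i = ∑ i, ∑ j, ∑ k, A i j k :=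
    (c2 fun i j k => A i k j).trans (c1 A)
  have c4 : ∑ i, ∑ j, ∑ k, A k i j = ∑ i, ∑ j, ∑ k, A i j k :=
    (c1 fun i j k => A j i k).trans (c2 A)
  have c5 : ∑ i, ∑ j, ∑ k, A k j i = ∑ i, ∑ j, ∑ k, A i j k :=
    (c2 fun i j k => A k i j).trans c4
  rw [hord]
  simp only [hdecomp, Finset.sum_add_distrib, c1 A, c2 A, c3, c4, c5]
  ring

/-! ### Application to the toric zonotope -/

theorem bracket_rotate (u v w : Space3) : bracket u v w = bracket v w u := by
  simp [bracket, Matrix.det_fin_three]; ring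

theorem bracket_swap (u v w : Space3) : bracket u v w = -bracket v u w := by
  simp [bracket, Matrix.det_fin_three]; ring

theorem bracket_self_left (u w : Space3) : bracket u u w = 0 := by
  linarith [bracket_swap u u w]

theorem sum_abs_bracket_eq_six_mul_cubicF {n : ℕ} (v : Fin n → Space3) (φ : Fin n → ℝ) :
    ∑ i, ∑ j, ∑ k, |bracket (v i) (v j) (v k)| * φ i * φ j * φ k = 6 * cubicF v φ := by
  refine sum_triple_eq_six_mul_sum_Ioi
    (fun i j k => |bracket (v i) (v j) (v k)| * φ i * φ j * φ k) ?_ ?_ ?_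
  · intro i j k
    simp only [bracket_rotate (v i)]
    ring
  · intro i j k
    simp only [bracket_swap (v i) (v j), abs_neg]
    ring
  · intro i k
    simp [bracket_self_left]

theorem ofLp_image_zonotope {n : ℕ} (v : Fin n → Space3) (φ : Fin n → ℝ) :
    WithLp.ofLp '' zonotope v φ = segmentSum Finset.univ fun i => φ i • (v i).ofLp := by
  have hz : zonotope v φ = segmentSum Finset.univ fun i => φ i • v i := by
    refine Finset.sum_congr rfl fun i _ => ?_
    rw [convexHull_pair, ← Set.image_smul]
    exact (image_segment ℝ (LinearMap.lsmul ℝ Space3 (φ i)).toAffineMap 0 (v i)).trans (by simp)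
  rw [hz]
  exact image_segmentSum (WithLp.linearEquiv 2 ℝ (Fin 3 → ℝ)).toLinearMap _ _

theorem isCompact_zonotope {n : ℕ} (v : Fin n → Space3) (φ : Fin n → ℝ) :
    IsCompact (zonotope v φ) := by
  have h := isCompact_segmentSum Finset.univ fun i => φ i • (v i).ofLp
  rw [← ofLp_image_zonotope] at h
  exact (EuclideanSpace.equiv (Fin 3) ℝ).toHomeomorph.isCompact_image.1 h

theorem volume_real_zonotope {n : ℕ} (v : Fin n → Space3) (hv : ∀ i, v i 2 ≠ 0)
    (φ : Fin n → ℝ) (hφ : ∀ i, 0 ≤ φ i) :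
    volume.real (zonotope v φ) = cubicF v φ := by
  have himg : volume.real (zonotope v φ) = volume.real (WithLp.ofLp '' zonotope v φ) := by
    rw [measureReal_def, measureReal_def, ← (PiLp.volume_preserving_ofLp (Fin 3)).measure_preimage,
      Set.preimage_image_eq _ (WithLp.ofLp_injective 2)]
    rw [ofLp_image_zonotope]
    exact (isCompact_segmentSum _ _).measurableSet.nullMeasurableSet
  have h := volume_real_segmentSum_three Finset.univ (fun i => φ i • (v i).ofLp) fun i => by
    rcases eq_or_ne (φ i) 0 with h | h
    · exact Or.inl (by simp [h])
    · exact Or.inr (mul_ne_zero h (hv i))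
  have hdet : ∀ i j k, |(Matrix.of ![φ i • (v i).ofLp, φ j • (v j).ofLp,
      φ k • (v k).ofLp]).det| = |bracket (v i) (v j) (v k)| * φ i * φ j * φ k := by
    intro i j k
    -- Nonnegativity of φ lets the weights move inside the absolute value.
    rw [← abs_of_nonneg (hφ i), ← abs_of_nonneg (hφ j), ← abs_of_nonneg (hφ k), ← abs_mul,
      ← abs_mul, ← abs_mul, abs_of_nonneg (hφ i), abs_of_nonneg (hφ j), abs_of_nonneg (hφ k)]
    congr 1
    simp [bracket, Matrix.det_fin_three]
    ring
  simp only [hdet, sum_abs_bracket_eq_six_mul_cubicF] at h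
  rw [himg, ofLp_image_zonotope]
  linarith

theorem mainTheorem5 (P : Set Space3) (hP : IsToricDiagram P)
    (n : ℕ) (v : Fin n → Space3) (hv : IsVertexList P v)
    (φ : Fin n → ℝ) (hφ : ∀ i, 0 ≤ φ i) :
    volume (zonotope v φ) = ENNReal.ofReal (cubicF v φ) ∧
    cubicF v φ = (volume (zonotope v φ)).toReal ∧
    ∀ N : ℕ,
      trialA N v φ = 27 / 32 * (N : ℝ) ^ 2 * cubicF v φ ∧
      trialA N v φ = 27 / 32 * (N : ℝ) ^ 2 * (volume (zonotope v φ)).toReal := by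
  -- Vertices lie at height 1, so no nonzero generator is horizontal.
  have hheight : ∀ i, v i 2 ≠ 0 := fun i => by
    rw [(hP.integralVertices (v i) (hv.range_eq ▸ Set.mem_range_self i)).2]
    exact one_ne_zero
  have hvol : (volume (zonotope v φ)).toReal = cubicF v φ :=
    volume_real_zonotope v hheight φ hφ
  have hA : ∀ N : ℕ, trialA N v φ = 27 / 32 * (N : ℝ) ^ 2 * cubicF v φ := fun N => by
    rw [trialA, sum_abs_bracket_eq_six_mul_cubicF]; ring
  refine ⟨?_, hvol.symm, fun N => ⟨hA N, by rw [hvol, hA N]⟩⟩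
  rw [← hvol, ENNReal.ofReal_toReal (isCompact_zonotope v φ).measure_lt_top.ne]
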